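/- Let $n \ge 0$ be an integer and let $\bar f, d \in \mathbb{R}$ with $0 \le d < \bar f$. Let $\mathcal{S}$ be the set of all $(x,f) \in \{0,1\}^n \times \mathbb{R}^{n+1}$, with coordinates $x = (x_1,\dots,x_n)$ and $f = (f_0,f_1,\dots,f_n)$, such that $$\sum_{j=0}^n f_j = d, \qquad f_0 = 0, \qquad -\bar f x_j \le f_j \le \bar f x_j \quad (j = 1,\dots,n).$$ Let $X$ be the set of all $(x,f) \in [0,1]^n \times \mathbb{R}^{n+1}$ such that $$f_0 = 0, \qquad \sum_{j=1}^n f_j = d, \qquad -\bar f x_j \le f_j \le \bar f x_j \quad (j = 1,\dots,n),$$ and such that, for every partition $(J_1,J_2,J_3)$ of $\{1,\dots,n\}$ into three pairwise disjoint, possibly empty sets, $$\sum_{j \in J_1} (\bar f - d)(\bar f x_j + f_j) + \sum_{j \in J_2} (\bar f - d)\, d\, x_j + \sum_{j \in J_3} d\,(\bar f x_j - f_j) \ \ge\ (\bar f - d)\, d.$$ Then $\operatorname{conv}(\mathcal{S}) = X$. -/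

import Mathlib

/-- The node-based mixed-integer set: lines `1, …, n` with on/off status `x j ∈ {0, 1}`, flow
`f (j + 1)` and flow limit `fbar j` (the coordinate `f j.succ` belongs to line `j : Fin n`), and
a generator with dispatch `f 0` in the interval `[lo, hi]` (its status is fixed to `1`). -/
def nodeSet (n : ℕ) (lo hi : ℝ) (fbar : Fin n → ℝ) (d : ℝ) :
    Set ((Fin n → ℝ) × (Fin (n + 1) → ℝ)) :=
  {p | (∀ j, p.1 j = 0 ∨ p.1 j = 1) ∧
    ∑ i, p.2 i = d ∧
    (lo ≤ p.2 0 ∧ p.2 0 ≤ hi) ∧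
    ∀ j : Fin n, -fbar j * p.1 j ≤ p.2 j.succ ∧ p.2 j.succ ≤ fbar j * p.1 j}

/-- `(J₁, J₂, J₃)` is an ordered partition of the set of lines; empty parts are allowed. -/
def IsTripartition {n : ℕ} (J₁ J₂ J₃ : Finset (Fin n)) : Prop :=
  Disjoint J₁ J₂ ∧ Disjoint J₁ J₃ ∧ Disjoint J₂ J₃ ∧ J₁ ∪ J₂ ∪ J₃ = Finset.univ

/-- The inequality attached to the triple `(J₁, J₂, J₃)` at the point `(x, f)`. -/
def PartitionIneq {n : ℕ} (fbar d : ℝ) (J₁ J₂ J₃ : Finset (Fin n))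
    (x : Fin n → ℝ) (f : Fin (n + 1) → ℝ) : Prop :=
  (fbar - d) * d ≤
    ∑ j ∈ J₁, (fbar - d) * (fbar * x j + f j.succ) +
      ∑ j ∈ J₂, (fbar - d) * d * x j +
      ∑ j ∈ J₃, d * (fbar * x j - f j.succ)

/-- The polyhedron `X` for `n` lines with the common flow limit `fbar`. -/
def polyhedronX (n : ℕ) (fbar d : ℝ) : Set ((Fin n → ℝ) × (Fin (n + 1) → ℝ)) :=
  {p | (∀ j, 0 ≤ p.1 j ∧ p.1 j ≤ 1) ∧
    (∀ J₁ J₂ J₃ : Finset (Fin n), IsTripartition J₁ J₂ J₃ →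
      PartitionIneq fbar d J₁ J₂ J₃ p.1 p.2) ∧
    p.2 0 = 0 ∧
    ∑ j : Fin n, p.2 j.succ = d ∧
    ∀ j : Fin n, -fbar * p.1 j ≤ p.2 j.succ ∧ p.2 j.succ ≤ fbar * p.1 j}

/-- The convex hull of a finite union of compact convex sets is compact. -/
theorem isCompact_convexHull_biUnion {ι E : Type*} [AddCommGroup E] [Module ℝ E]
    [TopologicalSpace E] [ContinuousAdd E] [ContinuousSMul ℝ E] (K : ι → Set E)
    (hK : ∀ i, IsCompact (K i)) (hc : ∀ i, Convex ℝ (K i)) (s : Finset ι) :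
    IsCompact (convexHull ℝ (⋃ i ∈ s, K i)) := by
  classical
  induction s using Finset.induction_on with
  | empty => simp
  | insert a s _ ih =>
    rw [Finset.set_biUnion_insert]
    rcases (K a).eq_empty_or_nonempty with h | h
    · simpa [h] using ih
    rcases (⋃ i ∈ s, K i).eq_empty_or_nonempty with h' | h'
    · rw [h', Set.union_empty, (hc a).convexHull_eq]
      exact hK a
    rw [convexHull_union h h', (hc a).convexHull_eq]
    have himg : convexJoin ℝ (K a) (convexHull ℝ (⋃ i ∈ s, K i)) =
        (fun q : (E × E) × ℝ => (1 - q.2) • q.1.1 + q.2 • q.1.2) ''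
          ((K a ×ˢ convexHull ℝ (⋃ i ∈ s, K i)) ×ˢ Set.Icc (0 : ℝ) 1) := by
      ext z
      simp only [mem_convexJoin, segment_eq_image, Set.mem_image, Set.mem_prod, Prod.exists]
      constructor
      · rintro ⟨u, hu, v, hv, θ, hθ, rfl⟩
        exact ⟨u, v, θ, ⟨⟨hu, hv⟩, hθ⟩, rfl⟩
      · rintro ⟨u, v, θ, ⟨⟨hu, hv⟩, hθ⟩, rfl⟩
        exact ⟨u, hu, v, hv, θ, hθ, rfl⟩
    rw [himg]
    exact (((hK a).prod ih).prod isCompact_Icc).image (by fun_prop)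

/-- An extreme point admits no feasible two-sided perturbation. -/
theorem eq_zero_of_mem_extremePoints {E : Type*} [AddCommGroup E] [Module ℝ E] {X : Set E}
    {z w : E} (hz : z ∈ X.extremePoints ℝ)
    (h : ∀ᶠ ε in nhds (0 : ℝ), z + ε • w ∈ X) : w = 0 := by
  have h' : ∀ᶠ ε in nhds (0 : ℝ), z + (-ε) • w ∈ X := by
    have : Filter.Tendsto (fun ε : ℝ => -ε) (nhds 0) (nhds 0) := by
      simpa using (continuous_neg (G := ℝ)).tendsto 0
    exact this.eventually h
  have h₂ : ∀ᶠ ε in nhdsWithin (0 : ℝ) (Set.Ioi 0), z + ε • w ∈ X ∧ z + (-ε) • w ∈ X :=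
    (h.and h').filter_mono nhdsWithin_le_nhds
  obtain ⟨ε, ⟨h1, h2⟩, hε⟩ := (h₂.and self_mem_nhdsWithin).exists
  have hε : (0 : ℝ) < ε := hε
  have := hz.2 h1 h2 ⟨1 / 2, 1 / 2, by norm_num, by norm_num, by norm_num, by module⟩
  have h3 : ε • w = 0 := by simpa using this
  exact (smul_eq_zero.1 h3).resolve_left hε.ne'

/-- A linear inequality survives a small perturbation if it does whenever it is tight. -/
theorem eventually_add_mul_le_add_mul {a b u v : ℝ} (hab : a ≤ b) (h : a = b → u = v) :
    ∀ᶠ ε in nhds (0 : ℝ), a + ε * u ≤ b + ε * v := by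
  rcases hab.eq_or_lt with he | hl
  · simp [he, h he]
  · have h1 : Filter.Tendsto (fun ε : ℝ => a + ε * u) (nhds 0) (nhds a) := by
      have : Continuous fun ε : ℝ => a + ε * u := by fun_prop
      simpa using this.tendsto 0
    have h2 : Filter.Tendsto (fun ε : ℝ => b + ε * v) (nhds 0) (nhds b) := by
      have : Continuous fun ε : ℝ => b + ε * v := by fun_prop
      simpa using this.tendsto 0
    exact (h1.eventually_lt h2 hl).mono fun _ => le_of_lt

/-- The roots of the root system `A₂` in a basis of the root lattice. -/
def IsRoot (u : ℤ × ℤ) : Prop :=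
  u = (1, 0) ∨ u = (-1, 0) ∨ u = (0, 1) ∨ u = (0, -1) ∨ u = (1, -1) ∨ u = (-1, 1)

/-- The determinant of two vectors of the lattice. -/
def latticeDet (u v : ℤ × ℤ) : ℤ := u.1 * v.2 - u.2 * v.1

theorem IsRoot.latticeDet_cases {u v : ℤ × ℤ} (hu : IsRoot u) (hv : IsRoot v) :
    (latticeDet u v = 1 ∨ latticeDet u v = -1) ∨ ∃ e : ℤ, u = e • v := by
  rcases hu with rfl | rfl | rfl | rfl | rfl | rfl <;>
  rcases hv with rfl | rfl | rfl | rfl | rfl | rfl <;>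
  first
  | exact Or.inl (by decide)
  | exact Or.inr ⟨1, by decide⟩
  | exact Or.inr ⟨-1, by decide⟩

theorem IsRoot.exists_latticeDet {u : ℤ × ℤ} (hu : IsRoot u) :
    ∃ v, latticeDet u v = 1 ∨ latticeDet u v = -1 := by
  rcases hu with rfl | rfl | rfl | rfl | rfl | rfl
  exacts [⟨(0, 1), by decide⟩, ⟨(0, 1), by decide⟩, ⟨(1, 0), by decide⟩, ⟨(1, 0), by decide⟩,
    ⟨(0, 1), by decide⟩, ⟨(0, 1), by decide⟩]

/-- Coefficients of an integral combination of roots are integral, provided that no nontrivial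
linear relation is supported on the indices with fractional coefficients. -/
theorem exists_int_of_isRoot {I : Type*} [Fintype I] [DecidableEq I] (t : I → ℝ)
    (ρ : I → ℤ × ℤ) (hρ : ∀ i, IsRoot (ρ i)) (m₁ m₂ : ℤ)
    (h₁ : ∑ i, t i * (ρ i).1 = m₁) (h₂ : ∑ i, t i * (ρ i).2 = m₂)
    (H : ∀ δ : I → ℝ, (∀ i, (∃ m : ℤ, t i = m) → δ i = 0) →
      ∑ i, δ i * (ρ i).1 = 0 → ∑ i, δ i * (ρ i).2 = 0 → δ = 0) :
    ∀ i, ∃ m : ℤ, t i = m := by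
  intro A
  by_contra hA
  have hdet : ∀ B, B ≠ A → (¬ ∃ m : ℤ, t B = m) →
      latticeDet (ρ A) (ρ B) = 1 ∨ latticeDet (ρ A) (ρ B) = -1 := by
    intro B hBA hB
    rcases (hρ A).latticeDet_cases (hρ B) with h | ⟨e, he⟩
    · exact h
    · have h0 := H (Pi.single A 1 + Pi.single B (-(e : ℝ))) (by
        intro i hi
        have h1 : i ≠ A := by rintro rfl; exact hA hi
        have h2 : i ≠ B := by rintro rfl; exact hB hi
        simp [h1, h2]) (by simp [add_mul, Finset.sum_add_distrib, Pi.single_apply, he])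
        (by simp [add_mul, Finset.sum_add_distrib, Pi.single_apply, he])
      have := congrFun h0 A
      simp [hBA.symm] at this
  obtain ⟨w, hw, hwi⟩ : ∃ w, (latticeDet (ρ A) w = 1 ∨ latticeDet (ρ A) w = -1) ∧
      ∀ i, i ≠ A → (∃ m : ℤ, t i = m) ∨ latticeDet (ρ i) w = 0 := by
    by_cases hB : ∃ B, B ≠ A ∧ ¬ ∃ m : ℤ, t B = m
    · obtain ⟨B, hBA, hB⟩ := hB
      refine ⟨ρ B, hdet B hBA hB, fun C hCA => ?_⟩
      by_cases hCB : C = B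
      · subst hCB
        right
        simp only [latticeDet]; ring
      left
      by_contra hC
      have h0 := H (Pi.single A (latticeDet (ρ B) (ρ C) : ℝ) +
          Pi.single B (latticeDet (ρ C) (ρ A) : ℝ) + Pi.single C (latticeDet (ρ A) (ρ B) : ℝ)) (by
        intro i hi
        have h1 : i ≠ A := by rintro rfl; exact hA hi
        have h2 : i ≠ B := by rintro rfl; exact hB hi
        have h3 : i ≠ C := by rintro rfl; exact hC hi
        simp [h1, h2, h3])
        (by
          simp [add_mul, Finset.sum_add_distrib, Pi.single_apply, latticeDet]
          ring)
        (by
          simp [add_mul, Finset.sum_add_distrib, Pi.single_apply, latticeDet]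
          ring)
      have := congrFun h0 C
      simp [hCA, hCB] at this
      have h' := hdet B hBA hB
      omega
    · push Not at hB
      obtain ⟨w, hw⟩ := (hρ A).exists_latticeDet
      exact ⟨w, hw, fun i hi => Or.inl (hB i hi)⟩
  have hsum : ∑ i, t i * (latticeDet (ρ i) w : ℝ) = ((m₁ * w.2 - m₂ * w.1 : ℤ) : ℝ) := by
    push_cast
    rw [← h₁, ← h₂, Finset.sum_mul, Finset.sum_mul, ← Finset.sum_sub_distrib]
    refine Finset.sum_congr rfl fun i _ => ?_
    simp only [latticeDet]
    push_cast
    ring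
  have hrest : ∑ i ∈ Finset.univ.erase A, t i * (latticeDet (ρ i) w : ℝ) ∈
      (Int.castRingHom ℝ).range := by
    refine Subring.sum_mem _ fun i hi => ?_
    rcases hwi i (Finset.ne_of_mem_erase hi) with ⟨m, hm⟩ | h0
    · exact ⟨m * latticeDet (ρ i) w, by simp [hm]⟩
    · exact ⟨0, by simp [h0]⟩
  obtain ⟨r, hr⟩ := hrest
  rw [← Finset.add_sum_erase _ _ (Finset.mem_univ A), ← hr] at hsum
  refine hA ?_
  rcases hw with hw | hw
  · refine ⟨m₁ * w.2 - m₂ * w.1 - r, ?_⟩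
    rw [hw] at hsum
    push_cast at hsum ⊢
    simp at hsum
    linarith
  · refine ⟨-(m₁ * w.2 - m₂ * w.1 - r), ?_⟩
    rw [hw] at hsum
    push_cast at hsum ⊢
    simp at hsum
    linarith

/-- The flow `d * c + F * b` of a vector with coordinates `(c, b)`. -/
def flow (F d : ℝ) (u : ℤ × ℤ) : ℝ := d * u.1 + F * u.2

theorem IsRoot.flow_ne_zero {F d : ℝ} (hd : 0 < d) (hdF : d < F) {u : ℤ × ℤ} (hu : IsRoot u) :
    flow F d u ≠ 0 := by
  rcases hu with rfl | rfl | rfl | rfl | rfl | rfl <;> simp [flow] <;>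
    first
    | exact hd.ne'
    | exact (hd.trans hdF).ne'
    | (intro h; linarith)

/-- `(V, D)` parametrizes the cone of all `(x, f)` spanned by two neighbouring rays among those
through `(1, -F)`, `(1, d - F)`, `(1, d)`, `(1, F)`: the point with parameters `0 ≤ y ≤ x` is
`(x, flow V * x + flow D * y)`. -/
structure IsChart (F d : ℝ) (V D : ℤ × ℤ) : Prop where
  root_V : IsRoot V
  root_D : IsRoot D
  root_add : IsRoot (V + D)
  bounds : ∀ x y : ℝ, 0 ≤ y → y ≤ x →
    -F * x ≤ flow F d V * x + flow F d D * y ∧ flow F d V * x + flow F d D * y ≤ F * x ∧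
    (F - d) * d * (V.1 * x + D.1 * y) ≤ (F - d) * (F * x + (flow F d V * x + flow F d D * y)) ∧
    (F - d) * d * (V.1 * x + D.1 * y) ≤ (F - d) * d * x ∧
    (F - d) * d * (V.1 * x + D.1 * y) ≤ d * (F * x - (flow F d V * x + flow F d D * y))

theorem exists_isChart {F d : ℝ} (hd : 0 < d) (hdF : d < F) {x f : ℝ}
    (h1 : -F * x ≤ f) (h2 : f ≤ F * x) :
    ∃ V D : ℤ × ℤ, ∃ y : ℝ, IsChart F d V D ∧ 0 ≤ y ∧ y ≤ x ∧
      f = flow F d V * x + flow F d D * y ∧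
      ((F - d) * d * (V.1 * x + D.1 * y) = (F - d) * (F * x + f) ∨
       (F - d) * d * (V.1 * x + D.1 * y) = (F - d) * d * x ∨
       (F - d) * d * (V.1 * x + D.1 * y) = d * (F * x - f)) := by
  have hF : 0 < F := hd.trans hdF
  have he : 0 < F - d := sub_pos.2 hdF
  rcases le_total f ((d - F) * x) with ha | ha
  · refine ⟨(0, -1), (1, 0), (F * x + f) / d, ⟨by simp [IsRoot], by simp [IsRoot],
      by simp [IsRoot], fun x y hy hyx => ?_⟩, div_nonneg (by linarith) hd.le,
      (div_le_iff₀ hd).2 (by linarith), ?_, Or.inl ?_⟩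
    · have hx : 0 ≤ x := hy.trans hyx
      have e1 := mul_nonneg hd.le hy
      have e2 := mul_nonneg hd.le (sub_nonneg.2 hyx)
      have e3 := mul_nonneg he.le e2
      have e4 := mul_nonneg he.le hx
      have e5 := mul_nonneg hd.le (mul_nonneg hF.le (sub_nonneg.2 hyx))
      have e6 := mul_nonneg hd.le (mul_nonneg hF.le hx)
      simp [flow]
      refine ⟨?_, ?_, ?_, ?_, ?_⟩ <;> nlinarith
    · simp [flow]; field_simp; ring
    · simp; field_simp
  rcases le_total f (d * x) with hb | hb
  · refine ⟨(1, 0), (0, -1), (d * x - f) / F, ⟨by simp [IsRoot], by simp [IsRoot],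
      by simp [IsRoot], fun x y hy hyx => ?_⟩, div_nonneg (by linarith) hF.le,
      (div_le_iff₀ hF).2 (by linarith), ?_, Or.inr (Or.inl ?_)⟩
    · have hx : 0 ≤ x := hy.trans hyx
      have e1 := mul_nonneg hF.le hy
      have e2 := mul_nonneg hF.le (sub_nonneg.2 hyx)
      have e3 := mul_nonneg he.le e2
      have e4 := mul_nonneg he.le hx
      have e5 := mul_nonneg hd.le e1
      have e6 := mul_nonneg hd.le hx
      simp [flow]
      refine ⟨?_, ?_, ?_, ?_⟩ <;> nlinarith
    · simp [flow]; field_simp; ring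
    · simp
  · refine ⟨(0, 1), (1, -1), (F * x - f) / (F - d), ⟨by simp [IsRoot], by simp [IsRoot],
      by simp [IsRoot], fun x y hy hyx => ?_⟩, div_nonneg (by linarith) he.le,
      (div_le_iff₀ he).2 (by linarith), ?_, Or.inr (Or.inr ?_)⟩
    · have hx : 0 ≤ x := hy.trans hyx
      have e1 := mul_nonneg he.le hy
      have e2 := mul_nonneg hF.le (sub_nonneg.2 hyx)
      have e3 := mul_nonneg he.le e2
      have e4 := mul_nonneg hF.le hx
      have e5 := mul_nonneg he.le (mul_nonneg hd.le (sub_nonneg.2 hyx))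
      have e6 := mul_nonneg hd.le hy
      simp [flow]
      refine ⟨?_, ?_, ?_, ?_, ?_⟩ <;> nlinarith
    · simp [flow]; field_simp; ring
    · simp; field_simp

theorem IsTripartition.sum_eq {n : ℕ} {J₁ J₂ J₃ : Finset (Fin n)} (h : IsTripartition J₁ J₂ J₃)
    (g : Fin n → ℝ) : ∑ j, g j = ∑ j ∈ J₁, g j + ∑ j ∈ J₂, g j + ∑ j ∈ J₃, g j := by
  obtain ⟨h12, h13, h23, hu⟩ := h
  rw [← hu, Finset.sum_union (Finset.disjoint_union_left.2 ⟨h13, h23⟩), Finset.sum_union h12]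

theorem nodeSet_subset_polyhedronX {n : ℕ} {F d : ℝ} (hd : 0 ≤ d) (hdF : d < F) :
    nodeSet n 0 0 (fun _ => F) d ⊆ polyhedronX n F d := by
  rintro ⟨x, f⟩ ⟨hx, hsum, ⟨hl, hu⟩, hb⟩
  dsimp only at hx hsum hl hu hb
  have hf0 : f 0 = 0 := le_antisymm hu hl
  have he : 0 < F - d := sub_pos.2 hdF
  rw [Fin.sum_univ_succ, hf0, zero_add] at hsum
  have hx0 : ∀ j, 0 ≤ x j := fun j => by rcases hx j with h | h <;> simp [h]
  refine ⟨fun j => by rcases hx j with h | h <;> simp [h], fun J₁ J₂ J₃ hJ => ?_, hf0, hsum, hb⟩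
  have n1 : ∀ j, 0 ≤ F * x j + f j.succ := fun j => by linarith [(hb j).1]
  have n3 : ∀ j, 0 ≤ F * x j - f j.succ := fun j => by linarith [(hb j).2]
  have s1 : 0 ≤ ∑ j ∈ J₁, (F * x j + f j.succ) := Finset.sum_nonneg fun j _ => n1 j
  have s2 : 0 ≤ ∑ j ∈ J₂, x j := Finset.sum_nonneg fun j _ => hx0 j
  have s3 : 0 ≤ ∑ j ∈ J₃, (F * x j - f j.succ) := Finset.sum_nonneg fun j _ => n3 j
  have c0 : 0 ≤ (F - d) * d := mul_nonneg he.le hd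
  simp only [PartitionIneq, ← Finset.mul_sum]
  have t1 := mul_nonneg he.le s1
  have t2 := mul_nonneg c0 s2
  have t3 := mul_nonneg hd s3
  by_cases h2 : ∃ j ∈ J₂, x j = 1
  · obtain ⟨j, hj, hj1⟩ := h2
    have : 1 ≤ ∑ j ∈ J₂, x j := hj1 ▸ Finset.single_le_sum (fun i _ => hx0 i) hj
    nlinarith
  · push Not at h2
    have hf2 : ∑ j ∈ J₂, f j.succ = 0 := Finset.sum_eq_zero fun j hj => by
      have := (hx j).resolve_right (h2 j hj)
      have := hb j
      simp_all
      linarith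
    have hxi : ∀ j, ∃ m : ℤ, x j = m := fun j => by
      rcases hx j with h | h
      exacts [⟨0, by simp [h]⟩, ⟨1, by simp [h]⟩]
    choose m hm using hxi
    rw [hJ.sum_eq, hf2] at hsum
    have hk : ∑ j ∈ J₁, (F * x j + f j.succ) - ∑ j ∈ J₃, (F * x j - f j.succ) =
        d + F * ((∑ j ∈ J₁, m j - ∑ j ∈ J₃, m j : ℤ) : ℝ) := by
      simp only [Finset.sum_add_distrib, Finset.sum_sub_distrib, ← Finset.mul_sum, hm]
      push_cast
      linarith
    have hF : 0 < F := by linarith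
    rcases le_or_gt 0 (∑ j ∈ J₁, m j - ∑ j ∈ J₃, m j) with hc | hc
    · have : (0 : ℝ) ≤ ((∑ j ∈ J₁, m j - ∑ j ∈ J₃, m j : ℤ) : ℝ) := by exact_mod_cast hc
      have h := mul_nonneg hF.le this
      have : d ≤ ∑ j ∈ J₁, (F * x j + f j.succ) := by linarith
      have := mul_le_mul_of_nonneg_left this he.le
      linarith
    · have : ((∑ j ∈ J₁, m j - ∑ j ∈ J₃, m j : ℤ) : ℝ) ≤ -1 := by
        exact_mod_cast Int.le_sub_one_of_lt hc
      have h := mul_le_mul_of_nonneg_left this hF.le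
      have : F - d ≤ ∑ j ∈ J₃, (F * x j - f j.succ) := by linarith
      have := mul_le_mul_of_nonneg_left this hd
      linarith

theorem convex_polyhedronX (n : ℕ) (F d : ℝ) : Convex ℝ (polyhedronX n F d) := by
  rintro ⟨x, f⟩ ⟨hx, hJ, h0, hs, hb⟩ ⟨x', f'⟩ ⟨hx', hJ', h0', hs', hb'⟩ a b ha hb0 hab
  dsimp only at hx hJ h0 hs hb hx' hJ' h0' hs' hb'
  have key : ∀ {p q p' q' : ℝ}, p ≤ q → p' ≤ q' → a * p + b * p' ≤ a * q + b * q' :=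
    fun h h' => add_le_add (mul_le_mul_of_nonneg_left h ha) (mul_le_mul_of_nonneg_left h' hb0)
  refine ⟨fun j => ?_, fun J₁ J₂ J₃ h => ?_, ?_, ?_, fun j => ?_⟩
  · have h1 := key (hx j).1 (hx' j).1
    have h2 := key (hx j).2 (hx' j).2
    simp
    constructor <;> linarith
  · have h1 := key (hJ J₁ J₂ J₃ h) (hJ' J₁ J₂ J₃ h)
    rw [← add_mul, hab, one_mul] at h1
    refine h1.trans_eq ?_
    simp only [mul_add, Finset.mul_sum, Prod.smul_mk, Prod.mk_add_mk, Pi.add_apply, Pi.smul_apply,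
      smul_eq_mul, mul_sub, Finset.sum_add_distrib, Finset.sum_sub_distrib]
    simp only [mul_left_comm, sub_mul]
    ring
  · simp [h0, h0']
  · simp [Finset.sum_add_distrib, ← Finset.mul_sum, hs, hs', ← add_mul, hab]
  · have h1 := key (hb j).1 (hb' j).1
    have h2 := key (hb j).2 (hb' j).2
    simp
    constructor <;> linarith

theorem isCompact_polyhedronX {n : ℕ} {F : ℝ} (d : ℝ) (hF : 0 < F) :
    IsCompact (polyhedronX n F d) := by
  have hsub : polyhedronX n F d ⊆
      Set.Icc ((fun _ => 0, fun _ => -F) : (Fin n → ℝ) × (Fin (n + 1) → ℝ))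
        (fun _ => 1, fun _ => F) := by
    rintro ⟨x, f⟩ ⟨hx, -, h0, -, hb⟩
    dsimp only at hx h0 hb
    refine ⟨⟨fun j => (hx j).1, fun i => ?_⟩, ⟨fun j => (hx j).2, fun i => ?_⟩⟩
    · refine Fin.cases (by simp [h0, hF.le]) (fun j => ?_) i
      have := mul_le_mul_of_nonneg_left (hx j).2 hF.le
      have := (hb j).1
      dsimp only
      linarith
    · refine Fin.cases (by simp [h0, hF.le]) (fun j => ?_) i
      have := mul_le_mul_of_nonneg_left (hx j).2 hF.le
      have := (hb j).2
      dsimp only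
      linarith
  refine isCompact_Icc.of_isClosed_subset ?_ hsub
  simp only [polyhedronX, PartitionIneq, Set.ofPred_and, Set.ofPred_forall]
  refine (isClosed_iInter fun j => ?_).inter ((isClosed_iInter fun J₁ => isClosed_iInter fun J₂ =>
    isClosed_iInter fun J₃ => isClosed_iInter fun _ => ?_).inter (IsClosed.inter ?_
    (IsClosed.inter ?_ (isClosed_iInter fun j => ?_))))
  · exact (isClosed_le (by fun_prop) (by fun_prop)).inter (isClosed_le (by fun_prop) (by fun_prop))
  · exact isClosed_le (by fun_prop) (by fun_prop)
  · exact isClosed_eq (by fun_prop) (by fun_prop)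
  · exact isClosed_eq (by fun_prop) (by fun_prop)
  · exact (isClosed_le (by fun_prop) (by fun_prop)).inter (isClosed_le (by fun_prop) (by fun_prop))

/-- The part of the mixed-integer set with a prescribed vector of statuses. -/
def nodeSlice (n : ℕ) (F d : ℝ) (P : Finset (Fin n)) : Set ((Fin n → ℝ) × (Fin (n + 1) → ℝ)) :=
  polyhedronX n F d ∩ {p | p.1 = fun j => if j ∈ P then 1 else 0}

theorem nodeSet_eq_iUnion {n : ℕ} {F d : ℝ} (hd : 0 ≤ d) (hdF : d < F) :
    nodeSet n 0 0 (fun _ => F) d = ⋃ P ∈ (Finset.univ : Finset (Finset (Fin n))),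
      nodeSlice n F d P := by
  classical
  ext ⟨x, f⟩
  simp only [Set.mem_iUnion, Finset.mem_univ, exists_const]
  constructor
  · intro h
    refine ⟨Finset.univ.filter fun j => x j = 1, nodeSet_subset_polyhedronX hd hdF h, ?_⟩
    funext j
    rcases h.1 j with h | h <;> simp_all
  · rintro ⟨P, ⟨hx, -, h0, hs, hb⟩, hP⟩
    dsimp only [Set.mem_ofPred_eq] at h0 hs hP hb
    refine ⟨fun j => ?_, ?_, ⟨h0.ge, h0.le⟩, hb⟩
    · have hP : x = fun j => if j ∈ P then 1 else 0 := hP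
      dsimp only
      rw [hP]
      dsimp only
      split_ifs <;> simp
    · simp [Fin.sum_univ_succ, h0, hs]

theorem isCompact_convexHull_nodeSet {n : ℕ} {F d : ℝ} (hd : 0 ≤ d) (hdF : d < F) :
    IsCompact (convexHull ℝ (nodeSet n 0 0 (fun _ => F) d)) := by
  rw [nodeSet_eq_iUnion hd hdF]
  refine isCompact_convexHull_biUnion _ (fun P => ?_) (fun P => ?_) _
  · exact (isCompact_polyhedronX d (hd.trans_lt hdF)).inter_right
      (isClosed_eq (by fun_prop) (by fun_prop))
  · refine (convex_polyhedronX n F d).inter ?_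
    rintro p (hp : p.1 = _) q (hq : q.1 = _) a b - - hab
    change a • p.1 + b • q.1 = _
    rw [hp, hq, ← add_smul, hab, one_smul]

theorem extremePoints_integral_of_slack {n : ℕ} {F d : ℝ} (hd : 0 ≤ d) (hdF : d < F)
    {z : (Fin n → ℝ) × (Fin (n + 1) → ℝ)} (hz : z ∈ (polyhedronX n F d).extremePoints ℝ)
    (hs : d = 0 ∨ ∀ J₁ J₂ J₃, IsTripartition J₁ J₂ J₃ → (F - d) * d <
      ∑ j ∈ J₁, (F - d) * (F * z.1 j + z.2 j.succ) + ∑ j ∈ J₂, (F - d) * d * z.1 j +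
        ∑ j ∈ J₃, d * (F * z.1 j - z.2 j.succ)) (j : Fin n) :
    z.1 j = 0 ∨ z.1 j = 1 := by
  classical
  obtain ⟨x, f⟩ := z
  obtain ⟨hx, hJ, h0, hsum, hb⟩ := hz.1
  dsimp only at hx hJ h0 hsum hb hs ⊢
  have hF : 0 < F := hd.trans_lt hdF
  have rigid : ∀ u v : Fin n → ℝ, ∑ j, v j = 0 → (∀ j, x j = 1 → u j = 0) →
      (∀ j, f j.succ = F * x j → v j = F * u j) →
      (∀ j, -F * x j = f j.succ → -F * u j = v j) → u = 0 ∧ v = 0 := by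
    intro u v hv h1 hp hm
    have hw := eq_zero_of_mem_extremePoints (w := (u, Fin.cons 0 v)) hz ?_
    · rw [Prod.mk_eq_zero] at hw
      exact ⟨hw.1, funext fun j => by simpa using congrFun hw.2 j.succ⟩
    have e1 := Filter.eventually_all.2 fun j =>
      eventually_add_mul_le_add_mul (u := u j) (v := 0) (hx j).2 (h1 j)
    have e2 := Filter.eventually_all.2 fun j =>
      eventually_add_mul_le_add_mul (hb j).2 (hp j)
    have e3 := Filter.eventually_all.2 fun j =>
      eventually_add_mul_le_add_mul (hb j).1 (hm j)
    have e4 : ∀ᶠ ε in nhds (0 : ℝ), d = 0 ∨ ∀ J₁ J₂ J₃, IsTripartition J₁ J₂ J₃ →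
        (F - d) * d + ε * 0 ≤ (∑ j ∈ J₁, (F - d) * (F * x j + f j.succ) +
          ∑ j ∈ J₂, (F - d) * d * x j + ∑ j ∈ J₃, d * (F * x j - f j.succ)) +
          ε * (∑ j ∈ J₁, (F - d) * (F * u j + v j) +
          ∑ j ∈ J₂, (F - d) * d * u j + ∑ j ∈ J₃, d * (F * u j - v j)) := by
      rcases hs with h | h
      · exact Filter.Eventually.of_forall fun _ => Or.inl h
      · refine Filter.Eventually.mono ?_ fun _ => Or.inr
        refine Filter.eventually_all.2 fun J₁ => Filter.eventually_all.2 fun J₂ =>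
          Filter.eventually_all.2 fun J₃ => Filter.eventually_all.2 fun hp => ?_
        exact eventually_add_mul_le_add_mul (h J₁ J₂ J₃ hp).le fun he =>
          absurd he (h J₁ J₂ J₃ hp).ne
    filter_upwards [e1, e2, e3, e4] with ε e1 e2 e3 e4
    refine ⟨fun j => ⟨?_, ?_⟩, fun J₁ J₂ J₃ hp => ?_, ?_, ?_, fun j => ⟨?_, ?_⟩⟩
    · have a1 := e2 j
      have a2 := e3 j
      have : 0 ≤ F * (x j + ε * u j) := by linarith
      simpa using nonneg_of_mul_nonneg_right this hF
    · simpa using e1 j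
    · rcases e4 with h | h
      · subst h
        simp only [PartitionIneq, mul_zero, zero_mul, Finset.sum_const_zero, add_zero]
        refine Finset.sum_nonneg fun j _ => mul_nonneg (by linarith) ?_
        have a2 := e3 j
        simp
        linarith
      · refine (add_zero ((F - d) * d)).ge.trans ?_
        have := h J₁ J₂ J₃ hp
        rw [mul_zero] at this
        refine this.trans_eq ?_
        simp only [mul_add, Finset.mul_sum, Prod.smul_mk, Prod.mk_add_mk, Pi.add_apply,
          Pi.smul_apply, smul_eq_mul, Fin.cons_succ, mul_sub, Finset.sum_add_distrib,
          Finset.sum_sub_distrib]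
        simp only [mul_left_comm, sub_mul, mul_sub, Finset.sum_sub_distrib]
        ring
    · simp [h0]
    · simp [Finset.sum_add_distrib, ← Finset.mul_sum, hsum, hv]
    · have := e3 j
      simp
      linarith
    · have := e2 j
      simp
      linarith
  by_contra hj
  push Not at hj
  have hxj : 0 < x j := lt_of_le_of_ne (hx j).1 (Ne.symm hj.1)
  have ray_j : f j.succ = F * x j ∨ -F * x j = f j.succ := by
    by_contra! hc
    have := (rigid (Pi.single j 1) 0 (by simp) (fun k hk => ?_) (fun k hk => ?_)
      (fun k hk => ?_)).1
    · simpa using congrFun this j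
    all_goals
      have hkj : k ≠ j := by rintro rfl; simp_all
      simp [hkj]
  obtain ⟨σ, hσ, hfj⟩ : ∃ σ : ℝ, σ * σ = 1 ∧ f j.succ = F * (σ * x j) := by
    rcases ray_j with h | h
    · exact ⟨1, by norm_num, by rw [h]; ring⟩
    · exact ⟨-1, by norm_num, by rw [← h]; ring⟩
  have hσ' : σ = 1 ∨ σ = -1 := mul_self_eq_one_iff.1 hσ
  have sgn : (f j.succ = F * x j → σ = 1) ∧ (-F * x j = f j.succ → σ = -1) := by
    have := mul_pos hF hxj
    rw [hfj]
    rcases hσ' with rfl | rfl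
    · exact ⟨fun _ => rfl, fun h => by linarith⟩
    · exact ⟨fun h => by linarith, fun _ => rfl⟩
  have others : ∀ k, k ≠ j → (f k.succ = F * x k ∨ -F * x k = f k.succ) ∧
      (x k = 0 ∨ x k = 1) := by
    intro k hkj
    have hray : f k.succ = F * x k ∨ -F * x k = f k.succ := by
      by_contra! hc
      have := (rigid (Pi.single j 1) (Pi.single j (σ * F) + Pi.single k (-(σ * F))) ?_
        (fun l hl => ?_) (fun l hl => ?_) (fun l hl => ?_)).1
      · simpa using congrFun this j
      · simp [Finset.sum_add_distrib]
      · have : l ≠ j := by rintro rfl; exact hj.2 hl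
        simp [this]
      · by_cases hlj : l = j
        · subst hlj
          simp [hkj.symm, sgn.1 hl]
        · have : l ≠ k := by rintro rfl; exact hc.1 hl
          simp [hlj, this]
      · by_cases hlj : l = j
        · subst hlj
          simp [hkj.symm, sgn.2 hl]
        · have : l ≠ k := by rintro rfl; exact hc.2 hl
          simp [hlj, this]
    refine ⟨hray, ?_⟩
    by_contra! hc
    have hxk : 0 < x k := lt_of_le_of_ne (hx k).1 (Ne.symm hc.1)
    have := mul_pos hF hxk
    obtain ⟨τ, hτ, hp, hm⟩ : ∃ τ : ℝ, τ * τ = 1 ∧ (f k.succ = F * x k → τ = 1) ∧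
        (-F * x k = f k.succ → τ = -1) := by
      rcases hray with h | h
      · exact ⟨1, by norm_num, fun _ => rfl, fun h' => by linarith⟩
      · exact ⟨-1, by norm_num, fun h' => by linarith, fun _ => rfl⟩
    have := (rigid (Pi.single j 1 + Pi.single k (-(σ * τ)))
      (Pi.single j (σ * F) + Pi.single k (-(σ * F))) ?_
        (fun l hl => ?_) (fun l hl => ?_) (fun l hl => ?_)).1
    · simpa [hkj.symm] using congrFun this j
    · simp [Finset.sum_add_distrib]
    · have h1 : l ≠ j := by rintro rfl; exact hj.2 hl
      have h2 : l ≠ k := by rintro rfl; exact hc.2 hl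
      simp [h1, h2]
    · by_cases hlj : l = j
      · subst hlj
        simp [hkj.symm, sgn.1 hl]
      · by_cases hlk : l = k
        · subst hlk
          simp [hkj, hp hl, mul_comm]
        · simp [hlj, hlk]
    · by_cases hlj : l = j
      · subst hlj
        simp [hkj.symm, sgn.2 hl]
      · by_cases hlk : l = k
        · subst hlk
          simp [hkj, hm hl, mul_comm]
        · simp [hlj, hlk]
  have all_ray : ∀ k, f k.succ = F * x k ∨ -F * x k = f k.succ := fun k => by
    by_cases hk : k = j
    · exact hk ▸ ray_j
    · exact (others k hk).1
  rcases hs with h | h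
  · subst h
    have hint : ∀ k, ∃ m : ℤ, k ≠ j → f k.succ = F * m := fun k => by
      by_cases hk : k = j
      · exact ⟨0, fun h => absurd hk h⟩
      obtain ⟨h1, h2⟩ := others k hk
      rcases h2 with h2 | h2 <;> rcases h1 with h1 | h1
      · exact ⟨0, fun _ => by simp [h1, h2]⟩
      · exact ⟨0, fun _ => by simp [← h1, h2]⟩
      · exact ⟨1, fun _ => by simp [h1, h2]⟩
      · exact ⟨-1, fun _ => by simp [← h1, h2]⟩
    choose m hm using hint
    rw [← Finset.add_sum_erase _ _ (Finset.mem_univ j),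
      Finset.sum_congr rfl fun k hk => hm k (Finset.ne_of_mem_erase hk), ← Finset.mul_sum, hfj,
      ← mul_add] at hsum
    have h3 : σ * x j + ((∑ k ∈ Finset.univ.erase j, m k : ℤ) : ℝ) = 0 := by
      push_cast
      exact (mul_eq_zero.1 hsum).resolve_left hF.ne'
    have hx1 : x j < 1 := lt_of_le_of_ne (hx j).2 hj.2
    generalize (∑ k ∈ Finset.univ.erase j, m k) = M at h3
    rcases hσ' with rfl | rfl
    · have h4 : ((0 : ℤ) : ℝ) < ((-M : ℤ) : ℝ) := by push_cast; linarith
      have h5 : ((-M : ℤ) : ℝ) < ((1 : ℤ) : ℝ) := by push_cast; linarith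
      have := Int.cast_lt.1 h4
      have := Int.cast_lt.1 h5
      omega
    · have h4 : ((0 : ℤ) : ℝ) < (M : ℝ) := by push_cast; linarith
      have h5 : (M : ℝ) < ((1 : ℤ) : ℝ) := by push_cast; linarith
      have := Int.cast_lt.1 h4
      have := Int.cast_lt.1 h5
      omega
  · have := h (Finset.univ.filter fun k => -F * x k = f k.succ) ∅
      (Finset.univ.filter fun k => ¬ -F * x k = f k.succ)
      ⟨by simp, Finset.disjoint_filter_filter_not _ _ _, by simp, by
        rw [Finset.union_empty]; exact Finset.filter_union_filter_not_eq _ _⟩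
    rw [Finset.sum_eq_zero, Finset.sum_eq_zero (s := Finset.filter _ _)] at this
    · simp at this
      have := mul_nonneg (sub_pos.2 hdF).le hd
      linarith
    · intro k hk
      rw [(all_ray k).resolve_right (Finset.mem_filter.1 hk).2]
      simp
    · intro k hk
      rw [← (Finset.mem_filter.1 hk).2]
      simp

theorem IsChart.le_partition_sum {n : ℕ} {F d : ℝ} {V D : Fin n → ℤ × ℤ}
    (hc : ∀ j, IsChart F d (V j) (D j)) {x y f : Fin n → ℝ} (hy : ∀ j, 0 ≤ y j)
    (hyx : ∀ j, y j ≤ x j) (hf : ∀ j, f j = flow F d (V j) * x j + flow F d (D j) * y j)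
    {J₁ J₂ J₃ : Finset (Fin n)} (hJ : IsTripartition J₁ J₂ J₃) :
    (F - d) * d * ∑ j, ((V j).1 * x j + (D j).1 * y j) ≤
      ∑ j ∈ J₁, (F - d) * (F * x j + f j) + ∑ j ∈ J₂, (F - d) * d * x j +
        ∑ j ∈ J₃, d * (F * x j - f j) := by
  rw [Finset.mul_sum, hJ.sum_eq]
  have h j := (hc j).bounds (x j) (y j) (hy j) (hyx j)
  simp only [← hf] at h
  exact add_le_add (add_le_add (Finset.sum_le_sum fun j _ => (h j).2.2.1)
    (Finset.sum_le_sum fun j _ => (h j).2.2.2.1)) (Finset.sum_le_sum fun j _ => (h j).2.2.2.2)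

theorem sum_flow {ι : Type*} (s : Finset ι) (F d : ℝ) (V D : ι → ℤ × ℤ) (x y : ι → ℝ) :
    ∑ j ∈ s, (flow F d (V j) * x j + flow F d (D j) * y j) =
      d * ∑ j ∈ s, ((V j).1 * x j + (D j).1 * y j) +
        F * ∑ j ∈ s, ((V j).2 * x j + (D j).2 * y j) := by
  simp only [Finset.mul_sum, ← Finset.sum_add_distrib]
  refine Finset.sum_congr rfl fun j _ => ?_
  simp only [flow]
  ring

theorem extremePoints_integral_of_tight {n : ℕ} {F d : ℝ} (hd : 0 < d) (hdF : d < F)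
    {x : Fin n → ℝ} {f : Fin (n + 1) → ℝ} (hz : (x, f) ∈ (polyhedronX n F d).extremePoints ℝ)
    {V D : Fin n → ℤ × ℤ} (hc : ∀ j, IsChart F d (V j) (D j)) {y : Fin n → ℝ}
    (hy : ∀ j, 0 ≤ y j) (hyx : ∀ j, y j ≤ x j)
    (hf : ∀ j, f j.succ = flow F d (V j) * x j + flow F d (D j) * y j)
    (hcnt : ∑ j, ((V j).1 * x j + (D j).1 * y j) = 1) (j : Fin n) :
    x j = 0 ∨ x j = 1 := by
  classical
  obtain ⟨hx, hJ, h0, hsum, hb⟩ := hz.1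
  dsimp only at hx hJ h0 hsum hb
  have hF : 0 < F := hd.trans hdF
  have rigid : ∀ u w : Fin n → ℝ, ∑ j, ((V j).1 * u j + (D j).1 * w j) = 0 →
      ∑ j, ((V j).2 * u j + (D j).2 * w j) = 0 → (∀ j, x j = 1 → u j = 0) →
      (∀ j, y j = 0 → w j = 0) → (∀ j, y j = x j → w j = u j) →
      ∀ j, u j = 0 ∧ flow F d (V j) * u j + flow F d (D j) * w j = 0 := by
    intro u w hu1 hu2 h1 hw0 hwu
    have hw := eq_zero_of_mem_extremePoints (w := (u, Fin.cons 0 fun j =>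
      flow F d (V j) * u j + flow F d (D j) * w j)) hz ?_
    · rw [Prod.mk_eq_zero] at hw
      exact fun j => ⟨congrFun hw.1 j, by simpa using congrFun hw.2 j.succ⟩
    have e1 := Filter.eventually_all.2 fun j =>
      eventually_add_mul_le_add_mul (u := u j) (v := 0) (hx j).2 (h1 j)
    have e2 := Filter.eventually_all.2 fun j =>
      eventually_add_mul_le_add_mul (u := 0) (v := w j) (hy j) fun h => (hw0 j h.symm).symm
    have e3 := Filter.eventually_all.2 fun j =>
      eventually_add_mul_le_add_mul (hyx j) (hwu j)
    filter_upwards [e1, e2, e3] with ε e1 e2 e3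
    have e2' : ∀ j, 0 ≤ y j + ε * w j := fun j => by simpa using e2 j
    have hf' : ∀ j : Fin n, f j.succ + ε * (flow F d (V j) * u j + flow F d (D j) * w j) =
        flow F d (V j) * (x j + ε * u j) + flow F d (D j) * (y j + ε * w j) := fun j => by
      rw [hf]; ring
    have hcnt' : ∑ j, ((V j).1 * (x j + ε * u j) + (D j).1 * (y j + ε * w j)) = 1 := by
      rw [← add_zero (1 : ℝ), ← hcnt, ← mul_zero ε, ← hu1, Finset.mul_sum,
        ← Finset.sum_add_distrib]
      exact Finset.sum_congr rfl fun j _ => by ring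
    have hbd j := (hc j).bounds _ _ (e2' j) (e3 j)
    simp only [← hf'] at hbd
    refine ⟨fun j => ⟨?_, ?_⟩, fun J₁ J₂ J₃ hp => ?_, ?_, ?_, fun j => ⟨?_, ?_⟩⟩
    · simpa using (e2' j).trans (e3 j)
    · simpa using e1 j
    · have := IsChart.le_partition_sum hc e2' e3 hf' hp
      rw [hcnt', mul_one] at this
      simpa [PartitionIneq] using this
    · simp [h0]
    · have := sum_flow Finset.univ F d V D u w
      rw [hu1, hu2] at this
      simp [Finset.sum_add_distrib (f := fun j : Fin n => f j.succ), ← Finset.mul_sum, hsum, this]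
    · simpa using (hbd j).1
    · simpa using (hbd j).2.1
  have hbal : ∑ j, ((V j).2 * x j + (D j).2 * y j) = 0 := by
    have := sum_flow Finset.univ F d V D x y
    rw [← Finset.sum_congr rfl fun j _ => hf j, hsum, hcnt] at this
    have : F * ∑ j, ((V j).2 * x j + (D j).2 * y j) = 0 := by linarith
    exact (mul_eq_zero.1 this).resolve_left hF.ne'
  let P : Fin n → ℤ × ℤ := fun j => if y j = x j then V j + D j else V j
  let q : Fin n → ℝ := fun j => if y j = x j then 0 else y j
  have hP : ∀ j, ((P j).1 : ℝ) * x j + (D j).1 * q j = (V j).1 * x j + (D j).1 * y j ∧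
      ((P j).2 : ℝ) * x j + (D j).2 * q j = (V j).2 * x j + (D j).2 * y j := by
    intro j
    by_cases h : y j = x j
    · simp [P, q, h, add_mul]
    · simp [P, q, h]
  have key := exists_int_of_isRoot (Sum.elim x q) (Sum.elim P D) ?_ 1 0 ?_ ?_ ?_ (Sum.inl j)
  · obtain ⟨m, hm⟩ := key
    simp only [Sum.elim_inl] at hm
    have h1 := (hx j).1
    have h2 := (hx j).2
    rw [hm] at h1 h2 ⊢
    have h1 : 0 ≤ m := by exact_mod_cast h1
    have h2 : m ≤ 1 := by exact_mod_cast h2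
    obtain rfl | rfl : m = 0 ∨ m = 1 := by omega
    all_goals simp
  · rintro (j | j)
    · by_cases h : y j = x j
      · simpa [P, h] using (hc j).root_add
      · simpa [P, h] using (hc j).root_V
    · exact (hc j).root_D
  · rw [Fintype.sum_sum_type, ← Finset.sum_add_distrib, Int.cast_one, ← hcnt]
    refine Finset.sum_congr rfl fun j _ => ?_
    rw [← (hP j).1]
    simp only [Sum.elim_inl, Sum.elim_inr]
    ring
  · rw [Fintype.sum_sum_type, ← Finset.sum_add_distrib, Int.cast_zero, ← hbal]
    refine Finset.sum_congr rfl fun j _ => ?_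
    rw [← (hP j).2]
    simp only [Sum.elim_inl, Sum.elim_inr]
    ring
  · intro δ hδ hδ1 hδ2
    rw [Fintype.sum_sum_type, ← Finset.sum_add_distrib] at hδ1 hδ2
    let w : Fin n → ℝ := fun j => if y j = x j then δ (Sum.inl j) else δ (Sum.inr j)
    have hr : ∀ j, y j = x j → δ (Sum.inr j) = 0 := fun j h =>
      hδ _ ⟨0, by simp [q, h]⟩
    have h := rigid (fun j => δ (Sum.inl j)) w ?_ ?_ (fun j hj => hδ _ ⟨1, by simp [hj]⟩)
      (fun j hj => ?_) (fun j hj => by simp [w, hj])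
    · funext i
      rcases i with j | j
      · exact (h j).1
      · by_cases hj : y j = x j
        · exact hr j hj
        · have := h j
          simp only [this.1, mul_zero, zero_add, w, hj, if_false] at this
          exact (mul_eq_zero.1 this.2).resolve_left ((hc j).root_D.flow_ne_zero hd hdF)
    · rw [← hδ1]
      refine Finset.sum_congr rfl fun j _ => ?_
      by_cases hj : y j = x j
      · simp [w, P, hj, hr j hj]; ring
      · simp [w, P, hj]; ring
    · rw [← hδ2]
      refine Finset.sum_congr rfl fun j _ => ?_
      by_cases hj : y j = x j
      · simp [w, P, hj, hr j hj]; ring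
      · simp [w, P, hj]; ring
    · by_cases hjx : y j = x j
      · simp only [w, hjx, if_true]
        exact hδ _ ⟨0, by simp [← hjx, hj]⟩
      · simp only [w, hjx, if_false]
        exact hδ _ ⟨0, by simp [q, hj]⟩

theorem extremePoints_polyhedronX_subset {n : ℕ} {F d : ℝ} (hd : 0 ≤ d) (hdF : d < F) :
    (polyhedronX n F d).extremePoints ℝ ⊆ nodeSet n 0 0 (fun _ => F) d := by
  classical
  rintro ⟨x, f⟩ hz
  have hX := hz.1
  obtain ⟨hx, hJ, h0, hsum, hb⟩ := hX
  dsimp only at hx hJ h0 hsum hb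
  refine ⟨?_, by simp [Fin.sum_univ_succ, h0, hsum], ⟨h0.ge, h0.le⟩, hb⟩
  dsimp only
  rcases hd.eq_or_lt with hd0 | hd0
  · exact extremePoints_integral_of_slack hd hdF hz (Or.inl hd0.symm)
  choose V D y hc hy hyx hf hmin using fun j => exists_isChart hd0 hdF (hb j).1 (hb j).2
  have hpos : 0 < (F - d) * d := mul_pos (sub_pos.2 hdF) hd0
  let p₁ : Fin n → Prop := fun j =>
    (F - d) * d * ((V j).1 * x j + (D j).1 * y j) = (F - d) * (F * x j + f j.succ)
  let p₂ : Fin n → Prop := fun j =>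
    (F - d) * d * ((V j).1 * x j + (D j).1 * y j) = (F - d) * d * x j
  have hp : IsTripartition (Finset.univ.filter p₁) (Finset.univ.filter fun j => ¬ p₁ j ∧ p₂ j)
      (Finset.univ.filter fun j => ¬ p₁ j ∧ ¬ p₂ j) := by
    refine ⟨?_, ?_, ?_, ?_⟩
    · exact Finset.disjoint_filter.2 fun j _ h h' => h'.1 h
    · exact Finset.disjoint_filter.2 fun j _ h h' => h'.1 h
    · exact Finset.disjoint_filter.2 fun j _ h h' => h'.2 h.2
    · ext j
      simp only [Finset.mem_union, Finset.mem_filter, Finset.mem_univ, true_and, iff_true]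
      tauto
  have hge := hJ _ _ _ hp
  have heq : (F - d) * d * ∑ j, ((V j).1 * x j + (D j).1 * y j) =
      ∑ j ∈ Finset.univ.filter p₁, (F - d) * (F * x j + f j.succ) +
        ∑ j ∈ Finset.univ.filter (fun j => ¬ p₁ j ∧ p₂ j), (F - d) * d * x j +
        ∑ j ∈ Finset.univ.filter (fun j => ¬ p₁ j ∧ ¬ p₂ j), d * (F * x j - f j.succ) := by
    rw [Finset.mul_sum, hp.sum_eq]
    congr 1
    · congr 1
      · exact Finset.sum_congr rfl fun j hj => (Finset.mem_filter.1 hj).2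
      · exact Finset.sum_congr rfl fun j hj => (Finset.mem_filter.1 hj).2.2
    · refine Finset.sum_congr rfl fun j hj => ?_
      have := (Finset.mem_filter.1 hj).2
      exact ((hmin j).resolve_left this.1).resolve_left this.2
  rw [PartitionIneq, ← heq] at hge
  have hge : 1 ≤ ∑ j, ((V j).1 * x j + (D j).1 * y j) :=
    le_of_mul_le_mul_left (by rwa [mul_one]) hpos
  rcases hge.eq_or_lt with hcnt | hcnt
  · exact extremePoints_integral_of_tight hd0 hdF hz hc hy hyx hf hcnt.symm
  · refine extremePoints_integral_of_slack hd hdF hz (Or.inr fun J₁ J₂ J₃ hJ => ?_)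
    refine lt_of_lt_of_le ?_ (IsChart.le_partition_sum hc hy hyx hf hJ)
    simpa using mul_lt_mul_of_pos_left hcnt hpos

theorem mainTheorem1 (n : ℕ) (fbar d : ℝ) (hd : 0 ≤ d) (hdf : d < fbar) :
    convexHull ℝ (nodeSet n 0 0 (fun _ => fbar) d) = polyhedronX n fbar d := by
  apply (convexHull_min (nodeSet_subset_polyhedronX hd hdf) (convex_polyhedronX n fbar d)).antisymm
  rw [← closure_convexHull_extremePoints (isCompact_polyhedronX d (hd.trans_lt hdf))
    (convex_polyhedronX n fbar d)]
  exact closure_minimal (convexHull_mono (extremePoints_polyhedronX_subset hd hdf))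
    (isCompact_convexHull_nodeSet hd hdf).isClosed
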